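/- Let $\mathcal P$ be a non-empty finite set of papers and $\mathcal R$ a finite set of reviewers with $|\mathcal R|=2k$ and $k\ge|\mathcal P|$ (the basic case is $k=|\mathcal P|$), and let $S\in[0,1]^{\mathcal R\times\mathcal P}$ be a similarity matrix. For $\mathcal R'\subseteq\mathcal R$, $\mathcal P'\subseteq\mathcal P$, let $\mathcal M(\mathcal R',\mathcal P';\ell_{rev},\ell_{pap})$ be the set of matrices $A\in\{0,1\}^{\mathcal R\times\mathcal P}$ that vanish outside $\mathcal R'\times\mathcal P'$ and satisfy $\sum_{r\in\mathcal R'}A_{rp}=\ell_{pap}$ for all $p\in\mathcal P'$ and $\sum_{p\in\mathcal P'}A_{rp}\le\ell_{rev}$ for all $r\in\mathcal R'$. The mean similarity of $A$ is the average of $S_{rp}$ over the pairs with $A_{rp}=1$. For $\mathcal R_2\subseteq\mathcal R$ and $\mathcal P_2\subseteq\mathcal P$ with $|\mathcal R_2|\ge|\mathcal P_2|$ and $|\mathcal R\setminus\mathcal R_2|\ge|\mathcal P|$ put $$Q(\mathcal R_2,\mathcal P_2)=\frac{1}{|\mathcal P|+|\mathcal P_2|}\Big[\max_{A\in\mathcal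 M(\mathcal R\setminus\mathcal R_2,\mathcal P;1,1)}\sum_{r,p}A_{rp}S_{rp}+\max_{B\in\mathcal M(\mathcal R_2,\mathcal P_2;1,1)}\sum_{r,p}B_{rp}S_{rp}\Big],$$ and let $f(\mathcal R_2)=\mathbb E[Q(\mathcal R_2,\mathcal P_2)]$, where $\mathcal P_2$ is uniform among the subsets of $\mathcal P$ of size $\beta|\mathcal P|$. Take $\beta=1$ (so $\mathcal P_2=\mathcal P$), and let $\mathcal R_2$ be uniform among the subsets of $\mathcal R$ of size $k$ (random split). Let $\mu\in\{1,\dots,10000\}$. Suppose $A^{(1)}\in\mathcal M(\mathcal R,\mathcal P;1,2)$ has mean similarity $s^{(1)}$, and $A^{(\mu)}\in\mathcal M(\mathcal R,\mathcal P;\mu,2\mu)$ has mean similarity $s^{(\mu)}$ and contains none of the pairs assigned in $A^{(1)}$. 1. If $\mu/4$ is an integer, then $$\mathbb E_{\mathcal R_2}[f(\mathcal R_2)]\ \ge\ \frac34 s^{(1)}+\Big(1-\frac{1.44}{\sqrt\mu}\Big)\frac14 s^{(\mu)}.$$ 2. For every such $\mu$ (with $\mu/4$ integral or not), with $\epsilon=\lceil\mu/4\rceil-\mu/4$,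 $$\mathbb E_{\mathcal R_2}[f(\mathcal R_2)]\ \ge\ \frac34 s^{(1)}+\frac{s^{(\mu)}}4\Big[1-\frac{\sqrt7+\sqrt6}{2\sqrt{\pi\mu}}-\frac{3\epsilon}{\lceil\mu/4\rceil}\Big].$$ -/

import Mathlib

open Finset
open scoped BigOperators

namespace TwoStage

noncomputable section

variable {R P : Type*} [Fintype R] [Fintype P] [DecidableEq R] [DecidableEq P]

/-- A `0/1` assignment matrix is represented by its set `A` of assigned pairs: `(r, p) ∈ A` means
that reviewer `r` is assigned to paper `p`. `IsAssignment R' P' lrev lpap A` says that `A` is a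
valid assignment on reviewers `R'` and papers `P'`: only pairs in `R' × P'` are assigned, every
paper of `P'` gets exactly `lpap` reviewers, every reviewer of `R'` gets at most `lrev` papers. -/
structure IsAssignment (R' : Finset R) (P' : Finset P) (lrev lpap : ℕ)
    (A : Finset (R × P)) : Prop where
  subset : A ⊆ R' ×ˢ P'
  paper_load : ∀ p ∈ P', #{r ∈ R' | (r, p) ∈ A} = lpap
  reviewer_load : ∀ r ∈ R', #{p ∈ P' | (r, p) ∈ A} ≤ lrev

/-- Total similarity of an assignment. -/
def totalSim (S : R → P → ℝ) (A : Finset (R × P)) : ℝ :=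
  ∑ a ∈ A, S a.1 a.2

/-- Mean similarity of an assignment (average over the assigned pairs). -/
def meanSim (S : R → P → ℝ) (A : Finset (R × P)) : ℝ :=
  totalSim S A / (#A : ℝ)

/-- Maximum total similarity over the valid assignments with all loads equal to one. -/
def optSim (S : R → P → ℝ) (R' : Finset R) (P' : Finset P) : ℝ :=
  sSup (totalSim S '' {A | IsAssignment R' P' 1 1 A})

/-- The supremum in `optSim` is a maximum as soon as there are enough reviewers. -/
theorem optSim_isGreatest (S : R → P → ℝ) (R' : Finset R) (P' : Finset P) (h : #P' ≤ #R') :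
    IsGreatest (totalSim S '' {A | IsAssignment R' P' 1 1 A}) (optSim S R' P') := by
  refine ⟨Set.Nonempty.csSup_mem ?_ (Set.toFinite _), fun x hx =>
    le_csSup (Set.toFinite _).bddAbove hx⟩
  obtain ⟨e⟩ : Nonempty (P' ↪ R') :=
    Function.Embedding.nonempty_of_card_le (by simpa using h)
  refine Set.Nonempty.image _ ⟨univ.image fun p : P' => ((e p : R), (p : P)), ?_, ?_, ?_⟩
  · intro a ha
    obtain ⟨p, -, rfl⟩ := mem_image.1 ha
    simp
  · intro p hp
    rw [card_eq_one]
    refine ⟨e ⟨p, hp⟩, ?_⟩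
    ext r
    simp only [mem_filter, mem_image, mem_univ, true_and, Prod.mk.injEq, mem_singleton]
    constructor
    · rintro ⟨-, q, rfl, rfl⟩
      rfl
    · rintro rfl
      exact ⟨(e _).2, ⟨p, hp⟩, rfl, rfl⟩
  · intro r _
    rw [card_le_one]
    intro p hp q hq
    simp only [mem_filter, mem_image, mem_univ, true_and, Prod.mk.injEq] at hp hq
    obtain ⟨-, p', h1, rfl⟩ := hp
    obtain ⟨-, q', h2, rfl⟩ := hq
    exact congrArg Subtype.val (e.injective (Subtype.ext (h1.trans h2.symm)))

/-- Mean similarity of the optimal two-stage assignment (all loads one) when the reviewers `R₂`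
are saved for the second stage and the papers `P₂` need a second-stage review. -/
def splitValue (S : R → P → ℝ) (R₂ : Finset R) (P₂ : Finset P) : ℝ :=
  (optSim S (univ \ R₂) univ + optSim S R₂ P₂) / ((Fintype.card P : ℝ) + (#P₂ : ℝ))

/-- Expected mean similarity when saving reviewers `R₂`: the set of second-stage papers is uniform
among the subsets of size `b` of all papers (where `b` is `β` times the number of papers). -/
def expectedValue (S : R → P → ℝ) (b : ℕ) (R₂ : Finset R) : ℝ :=
  𝔼 P₂ ∈ powersetCard b (univ : Finset P), splitValue S R₂ P₂

/-- Expected value of random split: `R₂` is uniform among the sets of `k` reviewers. -/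
def randomSplitValue (S : R → P → ℝ) (k b : ℕ) : ℝ :=
  𝔼 R₂ ∈ powersetCard k (univ : Finset R), expectedValue S b R₂

end

end TwoStage

namespace TwoStage

/-! A uniform half of the reviewers and its complement have the same law, so the value of random
split is the expected optimum on one random half `A`, divided by the number of papers
(`randomSplitValue_eq`). By Birkhoff's theorem this optimum dominates every fractional matching into
`A` (`sum_mul_le_optSim`), so it suffices to exhibit a good one for each `A`.

Pair up the reviewers so that the two assigned to a paper by `A₁` form its own pair
(`IsAssignment.exists_pairing`). A paper whose pair meets `A` is served by that pair. If both
members lie in `A`, each keeps half of its capacity, and these halves serve the papers whose pair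
misses `A`, along the edges of the second assignment (`weight`). An `A₁` edge then has expected
weight at least 1/2 - 1/8 = 3/8, which yields the term 3/4 of the bound.

For an edge of the second assignment, with `μ = m + 1`, the helper's pair is full and the paper's
pair is missed with probability at least 1/16. Given this event, Jensen reduces the expected weight
to an upper bound on the mean of a maximum of two counts, hence on the mean of their absolute
difference. An exchange argument (`sum_abs_exchange_le`) shows that this difference is worst when
both counts refer to the same pairs. It is then a centred hypergeometric variable, whose mean
absolute deviation is known exactly (`sum_abs_hypergeometric`). The outcome is the factor `1 - 1.43
/ √μ`, from which both claims follow. -/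

/-! ### Fractional matchings and Birkhoff's theorem. -/

/-- There are enough reviewers to extend a partial matching to all papers, and the added pairs have
nonnegative similarity. -/
theorem sum_le_optSim_of_injOn {R P : Type*} [Fintype R] [Fintype P] [DecidableEq R]
    [DecidableEq P] (S : R → P → ℝ) (hS : ∀ r p, 0 ≤ S r p) (R' : Finset R)
    (hc : Fintype.card P ≤ #R') (s : Finset P) (f : P → R) (hf : Set.InjOn f s)
    (hs : ∀ p ∈ s, f p ∈ R') : ∑ p ∈ s, S (f p) p ≤ optSim S R' univ := by
  obtain ⟨t, hst, htR, htc⟩ : ∃ t, s.image f ⊆ t ∧ t ⊆ R' ∧ #t = Fintype.card P :=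
    exists_subsuperset_card_eq (image_subset_iff.2 hs)
      (card_image_le.trans (card_le_univ s)) hc
  obtain ⟨g, hg⟩ := exists_equiv_extend_of_card_eq htc.symm hst hf
  have hB : IsAssignment R' univ 1 1 (univ.image fun p : P => ((g p : R), p)) := by
    refine ⟨?_, ?_, ?_⟩
    · intro a ha
      obtain ⟨p, -, rfl⟩ := mem_image.1 ha
      simp [htR (g p).2]
    · intro p _
      rw [card_eq_one]
      refine ⟨g p, ?_⟩
      ext r
      simp only [mem_filter, mem_image, mem_univ, true_and, Prod.mk.injEq, mem_singleton]
      constructor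
      · rintro ⟨-, q, rfl, rfl⟩
        rfl
      · rintro rfl
        exact ⟨htR (g p).2, p, rfl, rfl⟩
    · intro r _
      rw [card_le_one]
      intro p hp q hq
      simp only [mem_filter, mem_image, mem_univ, true_and, Prod.mk.injEq] at hp hq
      obtain ⟨p', h1, rfl⟩ := hp
      obtain ⟨q', h2, rfl⟩ := hq
      exact g.injective (Subtype.ext (h1.trans h2.symm))
  have hle := (optSim_isGreatest S R' (univ : Finset P) (by simpa using hc)).2 ⟨_, hB, rfl⟩
  refine le_trans ?_ hle
  rw [totalSim, sum_image (by intro p _ q _ h; exact (Prod.mk.inj h).2)]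
  calc ∑ p ∈ s, S (f p) p = ∑ p ∈ s, S (g p) p := sum_congr rfl fun p hp => by rw [hg p hp]
    _ ≤ ∑ p, S (g p) p := sum_le_univ_sum_of_nonneg fun p => hS _ _

theorem sum_perm_le_optSim {R P : Type*} [Fintype R] [Fintype P] [DecidableEq R]
    [DecidableEq P] (S : R → P → ℝ) (hS : ∀ r p, 0 ≤ S r p) (R' : Finset R)
    (hc : Fintype.card P ≤ #R') (σ : Equiv.Perm (R ⊕ P)) :
    ∑ r ∈ R', ∑ p, (if σ (Sum.inl r) = Sum.inr p then S r p else 0) ≤ optSim S R' univ := by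
  classical
  -- `f₀` only supplies default values, for papers whose preimage under `σ` is a paper; these lie
  -- outside `s`.
  obtain ⟨f₀⟩ : Nonempty (P ↪ R) :=
    Function.Embedding.nonempty_of_card_le (hc.trans (card_le_univ R'))
  set f : P → R := fun p => Sum.elim id f₀ (σ.symm (Sum.inr p)) with hf
  set s : Finset P := {p | ∃ r ∈ R', σ (Sum.inl r) = Sum.inr p} with hs
  have key : ∀ p r, σ (Sum.inl r) = Sum.inr p → f p = r := by
    intro p r h
    simp [hf, ← h]
  have hmem : ∀ p ∈ s, f p ∈ R' ∧ σ (Sum.inl (f p)) = Sum.inr p := by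
    intro p hp
    obtain ⟨r, hr, h⟩ := (mem_filter.1 hp).2
    rw [key p r h]
    exact ⟨hr, h⟩
  have := sum_le_optSim_of_injOn S hS R' hc s f (by
    intro p hp q hq h
    have h1 := (hmem p hp).2
    rw [h, (hmem q hq).2] at h1
    exact (Sum.inr.inj h1).symm) fun p hp => (hmem p hp).1
  refine le_trans (le_of_eq ?_) this
  rw [sum_comm, ← sum_subset (subset_univ s)]
  · refine sum_congr rfl fun p hp => ?_
    rw [sum_eq_single_of_mem (f p) (hmem p hp).1, if_pos (hmem p hp).2]
    intro r _ hr
    rw [if_neg fun h => hr (key p r h).symm]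
  · intro p _ hp
    refine sum_eq_zero fun r hr => if_neg fun h => hp ?_
    simp only [hs, mem_filter, mem_univ, true_and]
    exact ⟨r, hr, h⟩

/-- Every fractional matching of papers with the reviewers of `R'` is dominated by `optSim`. -/
theorem sum_mul_le_optSim {R P : Type*} [Fintype R] [Fintype P] [DecidableEq R]
    [DecidableEq P] (S : R → P → ℝ) (hS : ∀ r p, 0 ≤ S r p) (R' : Finset R)
    (hc : Fintype.card P ≤ #R') (x : R → P → ℝ) (hx : ∀ r p, 0 ≤ x r p)
    (hout : ∀ r ∉ R', ∀ p, x r p = 0) (hrow : ∀ r, ∑ p, x r p ≤ 1)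
    (hcol : ∀ p, ∑ r, x r p ≤ 1) : ∑ r, ∑ p, S r p * x r p ≤ optSim S R' univ := by
  classical
  -- The diagonal blocks absorb the slack of each reviewer and paper, which makes the matrix doubly
  -- stochastic with `x` as a corner.
  set M : Matrix (R ⊕ P) (R ⊕ P) ℝ := Matrix.fromBlocks
    (Matrix.diagonal fun r => 1 - ∑ p, x r p) (Matrix.of x) (Matrix.of x).transpose
    (Matrix.diagonal fun p => 1 - ∑ r, x r p) with hM
  have hMs : M ∈ doublyStochastic ℝ (R ⊕ P) := by
    rw [mem_doublyStochastic_iff_sum]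
    refine ⟨?_, ?_, ?_⟩
    · rintro (r | p) (r' | p')
      · simp only [hM, Matrix.fromBlocks_apply₁₁, Matrix.diagonal_apply]
        split_ifs
        · linarith [hrow r]
        · exact le_rfl
      · exact hx r p'
      · exact hx r' p
      · simp only [hM, Matrix.fromBlocks_apply₂₂, Matrix.diagonal_apply]
        split_ifs
        · linarith [hcol p]
        · exact le_rfl
    · rintro (r | p) <;> simp [hM, Fintype.sum_sum_type, Matrix.diagonal_apply]
    · rintro (r | p) <;> simp [hM, Fintype.sum_sum_type, Matrix.diagonal_apply]
  obtain ⟨w, hw0, hw1, hwM⟩ := exists_eq_sum_perm_of_mem_doublyStochastic hMs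
  have hxM : ∀ r p, x r p =
      ∑ σ : Equiv.Perm (R ⊕ P), w σ * (if σ (Sum.inl r) = Sum.inr p then 1 else 0) := by
    intro r p
    have : M (Sum.inl r) (Sum.inr p) = x r p := rfl
    rw [← this, ← hwM, Matrix.sum_apply]
    refine sum_congr rfl fun σ _ => ?_
    rw [Matrix.smul_apply, smul_eq_mul, Equiv.Perm.permMatrix, PEquiv.toMatrix_apply]
    simp [Equiv.toPEquiv_apply, eq_comm]
  have h1 : ∑ r, ∑ p, S r p * x r p = ∑ r ∈ R', ∑ p, S r p * x r p := by
    refine (sum_subset (subset_univ R') fun r _ hr => ?_).symm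
    exact sum_eq_zero fun p _ => by rw [hout r hr p, mul_zero]
  calc ∑ r, ∑ p, S r p * x r p = ∑ r ∈ R', ∑ p, S r p * x r p := h1
    _ = ∑ σ : Equiv.Perm (R ⊕ P), w σ *
          ∑ r ∈ R', ∑ p, (if σ (Sum.inl r) = Sum.inr p then S r p else 0) := by
        simp_rw [hxM, mul_sum]
        rw [sum_comm' (t' := univ) (s' := fun _ => R') (by simp)]
        refine (sum_congr rfl fun r _ => sum_comm).trans ?_
        rw [sum_comm]
        refine sum_congr rfl fun σ _ => ?_
        rw [sum_comm]
        refine sum_congr rfl fun r _ => sum_congr rfl fun p _ => ?_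
        split_ifs <;> simp [mul_comm]
    _ ≤ ∑ σ : Equiv.Perm (R ⊕ P), w σ * optSim S R' univ :=
        sum_le_sum fun σ _ => mul_le_mul_of_nonneg_left (sum_perm_le_optSim S hS R' hc σ) (hw0 σ)
    _ = optSim S R' univ := by rw [← sum_mul, hw1, one_mul]

/-! ### Mean absolute deviation of the hypergeometric distribution. -/

theorem card_filter_card_inter_eq {α : Type*} [DecidableEq α] {T W : Finset α} (hW : W ⊆ T)
    {K j : ℕ} (hj : j ≤ K) :
    #{A ∈ powersetCard K T | #(A ∩ W) = j} = (#W).choose j * (#T - #W).choose (K - j) := by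
  rw [← card_sdiff_of_subset hW, ← card_powersetCard, ← card_powersetCard, ← card_product]
  refine card_nbij' (fun A => (A ∩ W, A \ W)) (fun B => B.1 ∪ B.2) ?_ ?_ ?_ ?_
  · intro A hA
    simp only [coe_filter, mem_powersetCard, Set.mem_ofPred_eq] at hA
    have := card_inter_add_card_sdiff A W
    simp only [coe_product, Set.mem_prod, mem_coe, mem_powersetCard]
    exact ⟨⟨inter_subset_right, hA.2⟩, sdiff_subset_sdiff hA.1.1 subset_rfl, by omega⟩
  · rintro ⟨B, C⟩ hB
    simp only [coe_product, Set.mem_prod, mem_coe, mem_powersetCard] at hB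
    obtain ⟨⟨hB, hBc⟩, hC, hCc⟩ := hB
    have hd : Disjoint C W := (subset_sdiff.1 hC).2
    have h1 : (B ∪ C) ∩ W = B := by
      rw [union_inter_distrib_right, inter_eq_left.2 hB, disjoint_iff_inter_eq_empty.1 hd,
        union_empty]
    simp only [coe_filter, mem_powersetCard, Set.mem_ofPred_eq]
    refine ⟨⟨union_subset (hB.trans hW) (hC.trans sdiff_subset), ?_⟩, by rw [h1, hBc]⟩
    rw [card_union_of_disjoint (hd.symm.mono_left hB)]
    omega
  · intro A _
    exact sup_inf_sdiff A W
  · rintro ⟨B, C⟩ hB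
    simp only [coe_product, Set.mem_prod, mem_coe, mem_powersetCard] at hB
    obtain ⟨⟨hB, -⟩, hC, -⟩ := hB
    have hd : Disjoint C W := (subset_sdiff.1 hC).2
    refine Prod.ext ?_ ?_
    · change (B ∪ C) ∩ W = B
      rw [union_inter_distrib_right, inter_eq_left.2 hB, disjoint_iff_inter_eq_empty.1 hd,
        union_empty]
    · change (B ∪ C) \ W = C
      rw [union_sdiff_distrib, sdiff_eq_empty_iff_subset.2 hB, empty_union,
        sdiff_eq_self_of_disjoint hd]

theorem sum_powersetCard_card_inter {α : Type*} [DecidableEq α] {T W : Finset α} (hW : W ⊆ T)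
    (K : ℕ) (f : ℕ → ℝ) :
    ∑ A ∈ powersetCard K T, f #(A ∩ W) =
      ∑ j ∈ range (K + 1), ((#W).choose j * (#T - #W).choose (K - j) : ℕ) * f j := by
  rw [← sum_fiberwise_of_maps_to (t := range (K + 1)) (g := fun A => #(A ∩ W))]
  · refine sum_congr rfl fun j hj => ?_
    rw [← card_filter_card_inter_eq hW (Nat.lt_succ_iff.1 (mem_range.1 hj)), ← nsmul_eq_mul]
    refine sum_eq_card_nsmul fun A hA => ?_
    rw [(mem_filter.1 hA).2]
  · intro A hA
    have := card_le_card (inter_subset_left : A ∩ W ⊆ A)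
    rw [mem_powersetCard] at hA
    rw [mem_range]
    omega

/-- The summand telescopes, by the ratio of consecutive hypergeometric weights. The cutoff `K` shows
that the mean is `m`; the cutoff `m` gives half of the absolute deviation. -/
theorem sum_range_hypergeometric (m K : ℕ) (hm : m ≤ K) (n : ℕ) (hn : n ≤ K) :
    ∑ j ∈ range n, (((2 * m).choose j * (2 * K - 2 * m).choose (K - j) : ℕ) : ℝ)
        * (2 * K * (m - j)) =
      n * (K - 2 * m + n) * ((2 * m).choose n * (2 * K - 2 * m).choose (K - n) : ℕ) := by
  induction n with
  | zero => simp
  | succ n ih =>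
    rw [sum_range_succ, ih (by omega)]
    obtain ⟨d, rfl⟩ := Nat.exists_eq_add_of_le hn
    have h1 : ((2 * m).choose (n + 1) : ℝ) * (n + 1) = (2 * m).choose n * (2 * m - n) := by
      have := Nat.choose_succ_right_eq (2 * m) n
      rcases le_or_gt n (2 * m) with h | h
      · have h2 : ((2 * m - n : ℕ) : ℝ) = 2 * m - n := by rw [Nat.cast_sub h]; push_cast; ring
        rw [← h2]
        exact_mod_cast this
      · rw [Nat.choose_eq_zero_of_lt h, Nat.choose_eq_zero_of_lt (by omega)]
        simp
    have e1 : n + 1 + d - n = d + 1 := by omega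
    have e2 : n + 1 + d - (n + 1) = d := by omega
    rw [e1, e2]
    set b := 2 * (n + 1 + d) - 2 * m with hb
    have hbr : (b : ℝ) = 2 * (n + 1 + d) - 2 * m := by
      rw [hb, Nat.cast_sub (by omega)]
      push_cast
      ring
    have h3 : (b.choose (d + 1) : ℝ) * (d + 1) = b.choose d * (b - d) := by
      have := Nat.choose_succ_right_eq b d
      rcases le_or_gt d b with h | h
      · rw [← Nat.cast_sub h]
        exact_mod_cast this
      · rw [Nat.choose_eq_zero_of_lt h, Nat.choose_eq_zero_of_lt (by omega)]
        simp
    push_cast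
    rw [hbr] at h3
    linear_combination (-(b.choose d : ℝ) * (2 * (n + 1 + d) - 2 * m - d)) * h1
      + (((2 * m).choose n : ℝ) * (2 * m - n)) * h3

theorem sum_abs_hypergeometric (m K : ℕ) (hm : m ≤ K) :
    K * ∑ j ∈ range (K + 1), (((2 * m).choose j * (2 * K - 2 * m).choose (K - j) : ℕ) : ℝ)
        * |(j : ℝ) - m| = m * (K - m) * (m.centralBinom * (K - m).centralBinom : ℕ) := by
  set w : ℕ → ℝ := fun j => (((2 * m).choose j * (2 * K - 2 * m).choose (K - j) : ℕ) : ℝ) with hw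
  have h0 : ∑ j ∈ range (K + 1), w j * (2 * K * (m - j)) = 0 := by
    rw [sum_range_succ, sum_range_hypergeometric m K hm K le_rfl]
    simp only [hw]
    ring
  have h1 : ∑ j ∈ range (K + 1), (if j < m then w j * (2 * K * (m - j)) else 0)
      = m * (K - m) * (m.centralBinom * (K - m).centralBinom : ℕ) := by
    rw [← sum_filter]
    have : {j ∈ range (K + 1) | j < m} = range m := by
      ext j
      simp only [mem_filter, mem_range]
      omega
    rw [this, sum_range_hypergeometric m K hm m hm, Nat.centralBinom, Nat.centralBinom, Nat.mul_sub]
    ring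
  have h2 : ∀ j, w j * |(j : ℝ) - m| * (2 * K) =
      2 * (if j < m then w j * (2 * K * (m - j)) else 0) - w j * (2 * K * (m - j)) := by
    intro j
    split_ifs with h
    · have : (j : ℝ) < m := by exact_mod_cast h
      rw [abs_of_neg (by linarith)]
      ring
    · have : (m : ℝ) ≤ j := by exact_mod_cast not_lt.1 h
      rw [abs_of_nonneg (by linarith)]
      ring
  have h3 : (∑ j ∈ range (K + 1), w j * |(j : ℝ) - m|) * (2 * K) =
      2 * (m * (K - m) * (m.centralBinom * (K - m).centralBinom : ℕ)) := by
    rw [sum_mul, sum_congr rfl fun j _ => h2 j, sum_sub_distrib, h0, ← mul_sum, h1, sub_zero]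
  linarith

/-- Equivalently, `n * n.centralBinom / 4 ^ n` is nondecreasing in `n`. -/
theorem mul_centralBinom_mul_four_pow_le (n m : ℕ) :
    n * n.centralBinom * 4 ^ m ≤ (n + m) * (n + m).centralBinom := by
  induction m with
  | zero => simp
  | succ m ih =>
    have := Nat.succ_mul_centralBinom_succ (n + m)
    calc n * n.centralBinom * 4 ^ (m + 1) = 4 * (n * n.centralBinom * 4 ^ m) := by ring
      _ ≤ 4 * ((n + m) * (n + m).centralBinom) := Nat.mul_le_mul_left _ ih
      _ ≤ 2 * (2 * (n + m) + 1) * (n + m).centralBinom := by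
        rw [← mul_assoc]
        exact Nat.mul_le_mul_right _ (by omega)
      _ = _ := this.symm

theorem sq_centralBinom_mul_le (m : ℕ) :
    (m.centralBinom : ℝ) ^ 2 * (3 * m + 1) ≤ (4 ^ m) ^ 2 := by
  induction m with
  | zero => simp
  | succ m ih =>
    have h : ((m : ℝ) + 1) * (m + 1).centralBinom = 2 * (2 * m + 1) * m.centralBinom := by
      exact_mod_cast Nat.succ_mul_centralBinom_succ m
    have hm : (0 : ℝ) ≤ m := Nat.cast_nonneg m
    set c : ℝ := (m.centralBinom : ℝ)
    set d : ℝ := ((m + 1).centralBinom : ℝ)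
    have key : ((m : ℝ) + 1) ^ 2 * (d ^ 2 * (3 * (m + 1) + 1))
        ≤ (m + 1) ^ 2 * (16 * (c ^ 2 * (3 * m + 1))) := by
      have : ((m : ℝ) + 1) ^ 2 * (d ^ 2 * (3 * (m + 1) + 1))
          = 4 * c ^ 2 * ((2 * m + 1) ^ 2 * (3 * m + 4)) := by
        linear_combination (((m : ℝ) + 1) * d + 2 * (2 * m + 1) * c) * (3 * m + 4) * h
      rw [this]
      -- The right side exceeds the left by exactly `m`.
      have h4 : ((2 * m + 1 : ℝ)) ^ 2 * (3 * m + 4) ≤ 4 * ((m + 1) ^ 2 * (3 * m + 1)) := by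
        nlinarith
      nlinarith [mul_le_mul_of_nonneg_left h4 (sq_nonneg c)]
    have h5 := le_of_mul_le_mul_left key (by positivity)
    push_cast
    calc d ^ 2 * (3 * ((m : ℝ) + 1) + 1) ≤ 16 * (c ^ 2 * (3 * m + 1)) := h5
      _ ≤ 16 * (4 ^ m) ^ 2 := by linarith
      _ = (4 ^ (m + 1)) ^ 2 := by ring

theorem centralBinom_mul_sqrt_le (m : ℕ) :
    (m.centralBinom : ℝ) * √(3 * m + 1) ≤ 4 ^ m := by
  refine abs_le_of_sq_le_sq' ?_ (by positivity) |>.2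
  rw [mul_pow, Real.sq_sqrt (by positivity)]
  exact sq_centralBinom_mul_le m

/-- Mean absolute deviation of the number of sampled elements of `W` when half of `T` is
sampled. -/
theorem sum_abs_card_inter_sub_le {α : Type*} [DecidableEq α] {T W : Finset α} (hW : W ⊆ T)
    {m K : ℕ} (hT : #T = 2 * K) (hWc : #W = 2 * m) :
    ∑ A ∈ powersetCard K T, |(#(A ∩ W) : ℝ) - m| ≤ K.centralBinom * (m / √(3 * m + 1)) := by
  have hm : m ≤ K := by
    have := card_le_card hW
    omega
  rw [sum_powersetCard_card_inter hW K (fun j => |(j : ℝ) - m|), hT, hWc]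
  have h := sum_abs_hypergeometric m K hm
  set s := ∑ j ∈ range (K + 1), (((2 * m).choose j * (2 * K - 2 * m).choose (K - j) : ℕ) : ℝ)
        * |(j : ℝ) - m|
  rcases Nat.eq_zero_or_pos K with rfl | hK
  · obtain rfl : m = 0 := by omega
    simp [s]
  have hK' : (0 : ℝ) < K := by exact_mod_cast hK
  have hp : (0 : ℝ) < √(3 * m + 1) := by positivity
  have h2 : ((K : ℝ) - m) * (K - m).centralBinom * 4 ^ m ≤ K * K.centralBinom := by
    have := mul_centralBinom_mul_four_pow_le (K - m) m
    rw [Nat.sub_add_cancel hm] at this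
    rw [← Nat.cast_sub hm]
    exact_mod_cast this
  rw [mul_div_assoc', le_div_iff₀ hp]
  refine le_of_mul_le_mul_left ?_ hK'
  have hKm : (0 : ℝ) ≤ K - m := by
    rw [← Nat.cast_sub hm]
    positivity
  calc K * (s * √(3 * m + 1)) = (K * s) * √(3 * m + 1) := by ring
    _ = (m * (((K : ℝ) - m) * (K - m).centralBinom)) * (m.centralBinom * √(3 * m + 1)) := by
        rw [h]
        push_cast
        ring
    _ ≤ (m * (((K : ℝ) - m) * (K - m).centralBinom)) * 4 ^ m :=
        mul_le_mul_of_nonneg_left (centralBinom_mul_sqrt_le m) (by positivity)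
    _ = m * (((K : ℝ) - m) * (K - m).centralBinom * 4 ^ m) := by ring
    _ ≤ m * (K * K.centralBinom) := mul_le_mul_of_nonneg_left h2 (by positivity)
    _ = _ := by ring

/-! ### Full and free pairs in a random half. -/

/-- Indicator of the event that both members of pair `i` belong to `A`. -/
noncomputable def fullInd {ι : Type*} [DecidableEq ι] (A : Finset (ι × Bool)) (i : ι) : ℝ :=
  if (i, true) ∈ A ∧ (i, false) ∈ A then 1 else 0

/-- Indicator of the event that no member of pair `i` belongs to `A`. -/
noncomputable def freeInd {ι : Type*} [DecidableEq ι] (A : Finset (ι × Bool)) (i : ι) : ℝ :=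
  if (i, true) ∉ A ∧ (i, false) ∉ A then 1 else 0

/-- The permutation of reviewers induced by a permutation of pairs. -/
def pairPerm {ι : Type*} (σ : Equiv.Perm ι) : Equiv.Perm (ι × Bool) := σ.prodCongr (Equiv.refl Bool)

theorem mem_map_pairPerm {ι : Type*} (A : Finset (ι × Bool)) (σ : Equiv.Perm ι) (i : ι) (b : Bool) :
    (i, b) ∈ A.map (pairPerm σ).toEmbedding ↔ (σ.symm i, b) ∈ A := by
  rw [mem_map_equiv]
  rfl

section Pairs

variable {ι : Type*} [DecidableEq ι]

theorem fullInd_nonneg (A : Finset (ι × Bool)) (i : ι) : 0 ≤ fullInd A i := by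
  unfold fullInd; split_ifs <;> norm_num

theorem fullInd_le_one (A : Finset (ι × Bool)) (i : ι) : fullInd A i ≤ 1 := by
  unfold fullInd; split_ifs <;> norm_num

theorem fullInd_eq_zero {A : Finset (ι × Bool)} {a : ι × Bool} (ha : a ∉ A) :
    fullInd A a.1 = 0 := by
  obtain ⟨i, b⟩ := a
  unfold fullInd
  cases b <;> simp [ha]

theorem own_weight_nonneg (A : Finset (ι × Bool)) (a : ι × Bool) :
    0 ≤ if a ∈ A then 1 - fullInd A a.1 / 2 else 0 := by
  split_ifs
  · linarith [fullInd_le_one A a.1]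
  · exact le_rfl

theorem freeInd_nonneg (A : Finset (ι × Bool)) (i : ι) : 0 ≤ freeInd A i := by
  unfold freeInd; split_ifs <;> norm_num

theorem freeInd_le_one (A : Finset (ι × Bool)) (i : ι) : freeInd A i ≤ 1 := by
  unfold freeInd; split_ifs <;> norm_num

/-- The two sides differ only when one of the pairs is full and the other free; that case is the
triangle inequality. -/
theorem abs_fullInd_sub_freeInd_swap_le (A : Finset (ι × Bool)) (i j : ι) (w : ℝ) :
    |fullInd A i - freeInd A j + w| + |fullInd A j - freeInd A i + w| ≤
      |fullInd A i - freeInd A i + w| + |fullInd A j - freeInd A j + w| := by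
  have h : |w| + |w| ≤ |1 + w| + |-1 + w| := by
    have h2 : |w| + |w| = |(1 + w) + (-1 + w)| := by
      rw [← two_mul, show (1 + w) + (-1 + w) = 2 * w by ring, abs_mul, abs_two]
    rw [h2]
    exact abs_add_le _ _
  unfold fullInd freeInd
  by_cases h1 : (i, true) ∈ A <;> by_cases h2 : (i, false) ∈ A <;>
    by_cases h3 : (j, true) ∈ A <;> by_cases h4 : (j, false) ∈ A <;>
    simp [h1, h2, h3, h4] <;> linarith

theorem fullInd_sub_freeInd (A : Finset (ι × Bool)) (i : ι) :
    fullInd A i - freeInd A i =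
      (if (i, true) ∈ A then 1 else 0) + (if (i, false) ∈ A then 1 else 0) - 1 := by
  unfold fullInd freeInd
  by_cases h1 : (i, true) ∈ A <;> by_cases h2 : (i, false) ∈ A <;> simp [h1, h2]

theorem fullInd_add_freeInd (A : Finset (ι × Bool)) (i : ι) :
    fullInd A i + freeInd A i = |fullInd A i - freeInd A i| := by
  unfold fullInd freeInd
  by_cases h1 : (i, true) ∈ A <;> by_cases h2 : (i, false) ∈ A <;> simp [h1, h2]

theorem sum_fullInd_sub_freeInd (A : Finset (ι × Bool)) (U : Finset ι) :
    ∑ i ∈ U, fullInd A i - ∑ i ∈ U, freeInd A i = (#(A ∩ U ×ˢ univ) : ℝ) - #U := by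
  have h : (#(A ∩ U ×ˢ univ) : ℝ) =
      ∑ i ∈ U, ((if (i, true) ∈ A then (1 : ℝ) else 0) + (if (i, false) ∈ A then 1 else 0)) := by
    rw [inter_comm, ← filter_mem_eq_inter, card_filter, sum_product]
    push_cast
    refine sum_congr rfl fun i _ => ?_
    rw [Fintype.sum_bool]
  rw [h, ← sum_sub_distrib, sum_congr rfl fun i _ => fullInd_sub_freeInd A i, sum_sub_distrib]
  simp

theorem sum_powersetCard_map_perm {α : Type*} [DecidableEq α] (T : Finset α) (K : ℕ)
    (σ : Equiv.Perm α) (hσ : T.map σ.toEmbedding = T) (F : Finset α → ℝ) :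
    ∑ A ∈ powersetCard K T, F (A.map σ.toEmbedding) = ∑ A ∈ powersetCard K T, F A := by
  conv_rhs => rw [← hσ, powersetCard_map, sum_map]
  rfl

theorem sum_powersetCard_compl {α : Type*} [DecidableEq α] (T : Finset α) (K : ℕ)
    (hT : #T = 2 * K) (F : Finset α → ℝ) :
    ∑ A ∈ powersetCard K T, F (T \ A) = ∑ A ∈ powersetCard K T, F A := by
  have h : ∀ A ∈ powersetCard K T, T \ A ∈ powersetCard K T := by
    intro A hA
    rw [mem_powersetCard] at hA ⊢
    refine ⟨sdiff_subset, ?_⟩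
    rw [card_sdiff_of_subset hA.1]
    omega
  refine sum_nbij' (fun A => T \ A) (fun A => T \ A) h h ?_ ?_ fun _ _ => rfl
  · intro A hA
    exact Finset.sdiff_sdiff_eq_self (mem_powersetCard.1 hA).1
  · intro A hA
    exact Finset.sdiff_sdiff_eq_self (mem_powersetCard.1 hA).1

theorem card_powersetCard_half {α : Type*} (T : Finset α) (K : ℕ)
    (hT : #T = 2 * K) : #(powersetCard K T) = K.centralBinom := by
  rw [card_powersetCard, hT, Nat.centralBinom]

theorem fullInd_map_pairPerm (A : Finset (ι × Bool)) (σ : Equiv.Perm ι) (i : ι) :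
    fullInd (A.map (pairPerm σ).toEmbedding) i = fullInd A (σ.symm i) := by
  simp only [fullInd, mem_map_pairPerm]

theorem freeInd_map_pairPerm (A : Finset (ι × Bool)) (σ : Equiv.Perm ι) (i : ι) :
    freeInd (A.map (pairPerm σ).toEmbedding) i = freeInd A (σ.symm i) := by
  simp only [freeInd, mem_map_pairPerm]

/-- Swapping the pairs `i` and `j` preserves the law of `A` and fixes the remaining terms `w`.
Averaging over the swap reduces the claim to the pointwise inequality
`abs_fullInd_sub_freeInd_swap_le`. -/
theorem sum_abs_exchange_le (G : Finset ι) (K : ℕ) {U V : Finset ι} (hU : U ⊆ G) (hV : V ⊆ G)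
    {i j : ι} (hi : i ∈ U) (hiV : i ∉ V) (hj : j ∈ V) (hjU : j ∉ U) :
    ∑ A ∈ powersetCard K (G ×ˢ univ), |∑ a ∈ U, fullInd A a - ∑ a ∈ V, freeInd A a| ≤
      ∑ A ∈ powersetCard K (G ×ˢ univ),
        |∑ a ∈ U, fullInd A a - ∑ a ∈ insert i (V.erase j), freeInd A a| := by
  set w : Finset (ι × Bool) → ℝ :=
    fun A => ∑ a ∈ U.erase i, fullInd A a - ∑ a ∈ V.erase j, freeInd A a with hw
  have hσ : (G ×ˢ (univ : Finset Bool)).map (pairPerm (Equiv.swap i j)).toEmbedding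
      = G ×ˢ univ := by
    ext ⟨a, b⟩
    rw [mem_map_pairPerm, Equiv.symm_swap]
    simp only [mem_product, mem_univ, and_true]
    rcases eq_or_ne a i with rfl | hai
    · simp [hU hi, hV hj]
    rcases eq_or_ne a j with rfl | haj
    · simp [hU hi, hV hj]
    rw [Equiv.swap_apply_of_ne_of_ne hai haj]
  have hwσ : ∀ A, w (A.map (pairPerm (Equiv.swap i j)).toEmbedding) = w A := by
    intro A
    simp only [hw, fullInd_map_pairPerm, freeInd_map_pairPerm, Equiv.symm_swap]
    congr 1
    · refine sum_congr rfl fun a ha => ?_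
      rw [Equiv.swap_apply_of_ne_of_ne (ne_of_mem_erase ha)]
      rintro rfl
      exact hjU (mem_of_mem_erase ha)
    · refine sum_congr rfl fun a ha => ?_
      rw [Equiv.swap_apply_of_ne_of_ne _ (ne_of_mem_erase ha)]
      rintro rfl
      exact hiV (mem_of_mem_erase ha)
  have e1 : ∀ A, ∑ a ∈ U, fullInd A a - ∑ a ∈ V, freeInd A a
      = fullInd A i - freeInd A j + w A := by
    intro A
    rw [← add_sum_erase U _ hi, ← add_sum_erase V _ hj]
    simp only [hw]
    ring
  have e2 : ∀ A, ∑ a ∈ U, fullInd A a - ∑ a ∈ insert i (V.erase j), freeInd A a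
      = fullInd A i - freeInd A i + w A := by
    intro A
    rw [← add_sum_erase U _ hi, sum_insert fun h => hiV (mem_of_mem_erase h)]
    simp only [hw]
    ring
  simp_rw [e1, e2]
  have f1 := sum_powersetCard_map_perm (G ×ˢ univ) K (pairPerm (Equiv.swap i j)) hσ
    fun A => |fullInd A i - freeInd A j + w A|
  have f2 := sum_powersetCard_map_perm (G ×ˢ univ) K (pairPerm (Equiv.swap i j)) hσ
    fun A => |fullInd A i - freeInd A i + w A|
  simp only [fullInd_map_pairPerm, freeInd_map_pairPerm, hwσ, Equiv.symm_swap,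
    Equiv.swap_apply_left, Equiv.swap_apply_right] at f1 f2
  have := sum_le_sum fun A (_ : A ∈ powersetCard K (G ×ˢ univ)) =>
    abs_fullInd_sub_freeInd_swap_le A i j (w A)
  rw [sum_add_distrib, sum_add_distrib, f1, f2] at this
  linarith

theorem sum_abs_fullInd_sub_freeInd_le_self (G : Finset ι) (K : ℕ) {U : Finset ι} (hU : U ⊆ G) :
    ∀ (n : ℕ) (V : Finset ι), V ⊆ G → #V = #U → #(V \ U) = n →
    ∑ A ∈ powersetCard K (G ×ˢ univ), |∑ a ∈ U, fullInd A a - ∑ a ∈ V, freeInd A a| ≤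
      ∑ A ∈ powersetCard K (G ×ˢ univ), |∑ a ∈ U, fullInd A a - ∑ a ∈ U, freeInd A a| := by
  intro n
  induction n with
  | zero =>
    intro V _ hc hn
    rw [card_eq_zero, sdiff_eq_empty_iff_subset] at hn
    rw [eq_of_subset_of_card_le hn hc.ge]
  | succ n ih =>
    intro V hV hc hn
    obtain ⟨j, hj⟩ : (V \ U).Nonempty := card_pos.1 (by omega)
    have hn' : #(U \ V) = n + 1 := by
      have h1 := card_inter_add_card_sdiff U V
      have h2 := card_inter_add_card_sdiff V U
      rw [inter_comm] at h2
      omega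
    obtain ⟨i, hi⟩ : (U \ V).Nonempty := card_pos.1 (by omega)
    rw [mem_sdiff] at hi hj
    have hi' : i ∉ V.erase j := fun h => hi.2 (mem_of_mem_erase h)
    refine (sum_abs_exchange_le G K hU hV hi.1 hi.2 hj.1 hj.2).trans (ih _ ?_ ?_ ?_)
    · exact insert_subset (hU hi.1) ((erase_subset _ _).trans hV)
    · rw [card_insert_of_notMem hi', card_erase_of_mem hj.1, ← hc]
      have := card_pos.2 ⟨j, hj.1⟩
      omega
    · have he : V.erase j \ U = (V \ U).erase j := by
        ext a
        simp only [mem_sdiff, mem_erase, and_assoc]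
      rw [insert_sdiff_of_mem _ hi.1, he, card_erase_of_mem (mem_sdiff.2 hj), hn]
      rfl

theorem sum_abs_fullInd_sub_freeInd_le {G : Finset ι} {K m : ℕ} (hG : #G = K) {U V : Finset ι}
    (hU : U ⊆ G) (hV : V ⊆ G) (hUm : #U = m) (hVm : #V = m) :
    ∑ A ∈ powersetCard K (G ×ˢ univ), |∑ a ∈ U, fullInd A a - ∑ a ∈ V, freeInd A a| ≤
      K.centralBinom * (m / √(3 * m + 1)) := by
  refine (sum_abs_fullInd_sub_freeInd_le_self G K hU _ V hV (hVm.trans hUm.symm) rfl).trans ?_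
  simp_rw [sum_fullInd_sub_freeInd, hUm]
  refine sum_abs_card_inter_sub_le (product_subset_product hU subset_rfl) ?_ ?_
  · rw [card_product, hG, card_univ, Fintype.card_bool, mul_comm]
  · rw [card_product, hUm, card_univ, Fintype.card_bool, mul_comm]

/-- `C` may meet the two sides of the pairs unequally. Elements lying in only one of the sets can be
moved between them to equalise the sizes, without changing the combined sum. -/
theorem exists_balanced_pair {D₁ D₂ : Finset ι} {m : ℕ} (h : #D₁ + #D₂ = 2 * m) :
    ∃ U₁ U₂ : Finset ι, U₁ ⊆ D₁ ∪ D₂ ∧ U₂ ⊆ D₁ ∪ D₂ ∧ #U₁ = m ∧ #U₂ = m ∧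
      ∀ g : ι → ℝ, ∑ i ∈ D₁, g i + ∑ i ∈ D₂, g i = ∑ i ∈ U₁, g i + ∑ i ∈ U₂, g i := by
  have h1 := card_union_add_card_inter D₁ D₂
  have h2 : #(D₁ ∩ D₂) ≤ #(D₁ ∪ D₂) := card_le_card (inter_subset_union)
  obtain ⟨U, hU1, hU2, hUc⟩ := exists_subsuperset_card_eq (n := m)
    (inter_subset_union : D₁ ∩ D₂ ⊆ D₁ ∪ D₂) (by omega) (by omega)
  have hd : Disjoint (D₁ ∩ D₂) ((D₁ ∪ D₂) \ U) := disjoint_sdiff.mono_left hU1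
  refine ⟨U, (D₁ ∩ D₂) ∪ ((D₁ ∪ D₂) \ U), hU2,
    union_subset inter_subset_union sdiff_subset, hUc, ?_, fun g => ?_⟩
  · rw [card_union_of_disjoint hd, card_sdiff_of_subset hU2]
    omega
  · rw [sum_union hd, ← sum_union_inter, ← sum_sdiff hU2]
    ring

theorem sum_pairs {M : Type*} [AddCommMonoid M] {G : Finset ι} {C : Finset (ι × Bool)}
    (hC : C ⊆ G ×ˢ univ) (g : ι → M) : ∑ r ∈ C, g r.1 =
      ∑ i ∈ G with (i, true) ∈ C, g i + ∑ i ∈ G with (i, false) ∈ C, g i := by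
  have h : C = {r ∈ G ×ˢ (univ : Finset Bool) | r ∈ C} := by rw [filter_mem_eq_inter, inter_eq_right.2 hC]
  conv_lhs => rw [h]
  rw [sum_filter, sum_product, sum_filter, sum_filter, ← sum_add_distrib]
  refine sum_congr rfl fun i _ => ?_
  rw [Fintype.sum_bool]

theorem sum_abs_sub_two_mul_le {G : Finset ι} {K m : ℕ} (hG : #G = K) {C : Finset (ι × Bool)}
    {V : Finset ι} (hC : C ⊆ G ×ˢ univ) (hV : V ⊆ G) (hCm : #C = 2 * m) (hVm : #V = m) :
    ∑ A ∈ powersetCard K (G ×ˢ univ), |∑ r ∈ C, fullInd A r.1 - 2 * ∑ a ∈ V, freeInd A a| ≤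
      2 * (K.centralBinom * (m / √(3 * m + 1))) := by
  obtain ⟨U₁, U₂, h1, h2, c1, c2, hg⟩ := exists_balanced_pair (m := m)
    (D₁ := {i ∈ G | (i, true) ∈ C}) (D₂ := {i ∈ G | (i, false) ∈ C}) (by
      have := sum_pairs hC fun _ => 1
      simp only [sum_const, smul_eq_mul, mul_one] at this
      rw [← this, hCm])
  have hs : {i ∈ G | (i, true) ∈ C} ∪ {i ∈ G | (i, false) ∈ C} ⊆ G :=
    union_subset (filter_subset _ _) (filter_subset _ _)
  rw [two_mul (K.centralBinom * (m / √(3 * m + 1)) : ℝ)]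
  refine le_trans ?_ (add_le_add
    (sum_abs_fullInd_sub_freeInd_le hG (h1.trans hs) hV c1 hVm)
    (sum_abs_fullInd_sub_freeInd_le hG (h2.trans hs) hV c2 hVm))
  rw [← sum_add_distrib]
  refine sum_le_sum fun A _ => ?_
  rw [sum_pairs hC, hg]
  refine le_trans (le_of_eq ?_) (abs_add_le _ _)
  congr 1
  ring

theorem fullInd_sdiff {G : Finset ι} {i : ι} (hi : i ∈ G) (A : Finset (ι × Bool)) :
    fullInd ((G ×ˢ univ) \ A) i = freeInd A i := by
  simp [fullInd, freeInd, hi]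

theorem sum_fullInd_eq_sum_freeInd {G : Finset ι} {K : ℕ} (hG : #G = K) {i : ι} (hi : i ∈ G) :
    ∑ A ∈ powersetCard K (G ×ˢ univ), fullInd A i =
      ∑ A ∈ powersetCard K (G ×ˢ univ), freeInd A i := by
  rw [← sum_powersetCard_compl _ _ (by
    rw [card_product, hG, card_univ, Fintype.card_bool, mul_comm])]
  exact sum_congr rfl fun A _ => fullInd_sdiff hi A

/-- Full and free are equally likely by complementation and mutually exclusive, so twice the
probability is the mean absolute deviation for one pair. The bound `m / √(3 * m + 1)` equals 1/2 at
`m = 1`. -/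
theorem sum_freeInd_le {G : Finset ι} {K : ℕ} (hG : #G = K) {i : ι} (hi : i ∈ G) :
    ∑ A ∈ powersetCard K (G ×ˢ univ), freeInd A i ≤ K.centralBinom / 4 := by
  have h := sum_abs_fullInd_sub_freeInd_le hG (singleton_subset_iff.2 hi)
    (singleton_subset_iff.2 hi) (card_singleton i) (card_singleton i)
  simp only [sum_singleton, ← fullInd_add_freeInd, sum_add_distrib,
    sum_fullInd_eq_sum_freeInd hG hi] at h
  have h4 : √(3 * ((1 : ℕ) : ℝ) + 1) = 2 := by
    rw [show (3 * ((1 : ℕ) : ℝ) + 1) = 2 ^ 2 by norm_num, Real.sqrt_sq (by norm_num)]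
  rw [h4] at h
  push_cast at h
  linarith

theorem sum_fullInd_le {G : Finset ι} {K : ℕ} (hG : #G = K) {i : ι} (hi : i ∈ G) :
    ∑ A ∈ powersetCard K (G ×ˢ univ), fullInd A i ≤ K.centralBinom / 4 :=
  (sum_fullInd_eq_sum_freeInd hG hi).trans_le (sum_freeInd_le hG hi)

theorem max_eq_half_add_abs_sub (a b : ℝ) : max a b = (a + b + |a - b|) / 2 := by
  rcases le_total a b with h | h
  · rw [max_eq_right h, abs_of_nonpos (by linarith)]
    ring
  · rw [max_eq_left h, abs_of_nonneg (by linarith)]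
    ring

theorem sum_max_le {G : Finset ι} {K m : ℕ} (hG : #G = K) {C : Finset (ι × Bool)}
    {V : Finset ι} (hC : C ⊆ G ×ˢ univ) (hV : V ⊆ G) (hCm : #C = 2 * m) (hVm : #V = m) :
    ∑ A ∈ powersetCard K (G ×ˢ univ),
        (2 + max (∑ r ∈ C, fullInd A r.1) (2 * ∑ a ∈ V, freeInd A a)) ≤
      K.centralBinom * (2 + m / 2 + m / √(3 * m + 1)) := by
  have hT : #(G ×ˢ (univ : Finset Bool)) = 2 * K := by
    rw [card_product, hG, card_univ, Fintype.card_bool, mul_comm]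
  have hx : ∑ A ∈ powersetCard K (G ×ˢ univ), ∑ r ∈ C, fullInd A r.1 ≤
      2 * m * (K.centralBinom / 4) := by
    rw [sum_comm]
    refine (sum_le_card_nsmul C _ _ fun r hr =>
      sum_fullInd_le hG (mem_product.1 (hC hr)).1).trans_eq ?_
    rw [nsmul_eq_mul, hCm]
    push_cast
    ring
  have hy : ∑ A ∈ powersetCard K (G ×ˢ univ), ∑ a ∈ V, freeInd A a ≤
      m * (K.centralBinom / 4) := by
    rw [sum_comm]
    refine (sum_le_card_nsmul V _ _ fun a ha => sum_freeInd_le hG (hV ha)).trans_eq ?_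
    rw [nsmul_eq_mul, hVm]
  have hz := sum_abs_sub_two_mul_le hG hC hV hCm hVm
  simp_rw [max_eq_half_add_abs_sub]
  rw [sum_add_distrib, sum_const, card_powersetCard_half _ _ hT, nsmul_eq_mul, ← sum_div,
    sum_add_distrib, sum_add_distrib, ← mul_sum]
  linarith

theorem fullInd_union_of_ne (A : Finset (ι × Bool)) {l v : ι} (h : v ≠ l) :
    fullInd (A ∪ {l} ×ˢ univ) v = fullInd A v := by
  simp [fullInd, h]

theorem freeInd_union_of_ne (A : Finset (ι × Bool)) {l v : ι} (h : v ≠ l) :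
    freeInd (A ∪ {l} ×ˢ univ) v = freeInd A v := by
  simp [freeInd, h]

/-- Conditioning: given that pair `l` is full and pair `i` free, `A` is a uniform half of the other
pairs. -/
theorem sum_fullInd_mul_freeInd [Fintype ι] {k : ℕ} {i l : ι} (hil : i ≠ l)
    (g : Finset (ι × Bool) → ℝ) :
    ∑ A ∈ powersetCard (k + 2) (univ : Finset (ι × Bool)), fullInd A l * freeInd A i * g A =
      ∑ A ∈ powersetCard k ((univ \ {i, l} : Finset ι) ×ˢ (univ : Finset Bool)),
        g (A ∪ {l} ×ˢ univ) := by
  have hcond : ∀ A : Finset (ι × Bool), fullInd A l * freeInd A i * g A =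
      if ((l, true) ∈ A ∧ (l, false) ∈ A) ∧ (i, true) ∉ A ∧ (i, false) ∉ A then g A else 0 := by
    intro A
    unfold fullInd freeInd
    split_ifs <;> simp_all
  have hdis : ∀ A ⊆ (univ \ {i, l} : Finset ι) ×ˢ (univ : Finset Bool),
      Disjoint A ({l} ×ˢ univ) := by
    intro A hA
    rw [disjoint_left]
    intro a ha hal
    have := hA ha
    simp only [mem_product, mem_sdiff, mem_univ, true_and, mem_insert, mem_singleton, and_true,
      not_or] at this hal
    exact this.2 hal
  simp_rw [hcond]
  rw [← sum_filter]
  refine sum_nbij' (fun A => A \ ({l} ×ˢ univ)) (fun A => A ∪ {l} ×ˢ univ) ?_ ?_ ?_ ?_ ?_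
  · intro A hA
    simp only [mem_filter, mem_powersetCard, subset_univ, true_and] at hA
    obtain ⟨hc, ⟨h1, h2⟩, h3, h4⟩ := hA
    have hs : ({l} ×ˢ univ : Finset (ι × Bool)) ⊆ A := by
      rintro ⟨a, b⟩ hab
      obtain rfl : a = l := mem_singleton.1 (mem_product.1 hab).1
      cases b <;> assumption
    rw [mem_powersetCard]
    refine ⟨?_, ?_⟩
    · rintro ⟨a, b⟩ hab
      simp only [mem_sdiff, mem_product, mem_singleton, mem_univ, and_true] at hab
      simp only [mem_product, mem_sdiff, mem_univ, true_and, mem_insert, mem_singleton, and_true,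
        not_or]
      refine ⟨?_, hab.2⟩
      rintro rfl
      cases b <;> exact absurd hab.1 (by assumption)
    · rw [card_sdiff_of_subset hs, hc, card_product]
      simp
  · intro A hA
    rw [mem_powersetCard] at hA
    simp only [mem_filter, mem_powersetCard, subset_univ, true_and]
    refine ⟨?_, by simp, ?_, ?_⟩
    · rw [card_union_of_disjoint (hdis A hA.1), hA.2, card_product]
      simp
    all_goals
      intro h
      rcases mem_union.1 h with h | h
      · have := hA.1 h
        simp at this
      · simp [hil] at h
  · intro A hA
    simp only [mem_filter, mem_powersetCard, subset_univ, true_and] at hA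
    obtain ⟨hc, ⟨h1, h2⟩, -⟩ := hA
    refine sdiff_union_of_subset ?_
    rintro ⟨a, b⟩ hab
    obtain rfl : a = l := mem_singleton.1 (mem_product.1 hab).1
    cases b <;> assumption
  · intro A hA
    exact union_sdiff_cancel_right (hdis A (mem_powersetCard.1 hA).1)
  · intro A hA
    simp only [mem_filter, mem_powersetCard, subset_univ, true_and] at hA
    obtain ⟨hc, ⟨h1, h2⟩, -⟩ := hA
    rw [sdiff_union_of_subset]
    rintro ⟨a, b⟩ hab
    obtain rfl : a = l := mem_singleton.1 (mem_product.1 hab).1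
    cases b <;> assumption

theorem one_le_sum_fullInd {A C : Finset (ι × Bool)} {l : ι} {b : Bool} (h : fullInd A l = 1)
    (hC : (l, b) ∈ C) : 1 ≤ ∑ r ∈ C, fullInd A r.1 := by
  rw [← h]
  exact single_le_sum (f := fun r : ι × Bool => fullInd A r.1)
    (fun r _ => fullInd_nonneg A r.1) hC

theorem centralBinom_succ_le (n : ℕ) : (n + 1).centralBinom ≤ 4 * n.centralBinom := by
  refine le_of_mul_le_mul_left ?_ n.succ_pos
  rw [Nat.succ_eq_add_one, Nat.succ_mul_centralBinom_succ]
  nlinarith [n.centralBinom_pos]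

theorem centralBinom_add_two_le (n : ℕ) : (n + 2).centralBinom ≤ 16 * n.centralBinom :=
  calc (n + 2).centralBinom ≤ 4 * (n + 1).centralBinom := centralBinom_succ_le (n + 1)
    _ ≤ 4 * (4 * n.centralBinom) := Nat.mul_le_mul_left 4 (centralBinom_succ_le n)
    _ = 16 * n.centralBinom := by ring

/-- Lower bound for the expected weight of the edge between a member of pair `l` and the paper of
pair `i` in the fractional matching that gives this edge weight `1 / max (X, Y)`. -/
theorem sum_edge_weight_ge [Fintype ι] {k m : ℕ} (hk : Fintype.card ι = k) (hmk : m + 2 ≤ k)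
    {i l : ι} {b : Bool} {C : Finset (ι × Bool)} {V : Finset ι} (hC : #C = 2 * (m + 1))
    (hCi : ∀ r ∈ C, r.1 ≠ i) (hCl : (l, b) ∈ C) (hV : #V ≤ m + 1) (hVi : i ∈ V) (hVl : l ∉ V) :
    (k.centralBinom : ℝ) / 16 / (2 + m / 2 + m / √(3 * m + 1)) ≤
      ∑ A ∈ powersetCard k (univ : Finset (ι × Bool)), fullInd A l * freeInd A i *
        (max (∑ r ∈ C, fullInd A r.1) (2 * ∑ a ∈ V, freeInd A a))⁻¹ := by
  obtain ⟨K, rfl⟩ := Nat.exists_eq_add_of_le' (show 2 ≤ k by omega)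
  have hil : i ≠ l := by
    rintro rfl
    exact hVl hVi
  set G : Finset ι := univ \ {i, l} with hG
  have hGc : #G = K := by
    rw [hG, card_sdiff_of_subset (subset_univ _), card_univ, hk, card_pair hil]
    rfl
  have hT : #(G ×ˢ (univ : Finset Bool)) = 2 * K := by
    rw [card_product, hGc, card_univ, Fintype.card_bool, mul_comm]
  rw [sum_fullInd_mul_freeInd hil
    fun A => (max (∑ r ∈ C, fullInd A r.1) (2 * ∑ a ∈ V, freeInd A a))⁻¹]
  -- Exactly two reviewers are discarded, including every member of pair `l` in `C`; they account
  -- for the summand 2 in `M`. On the other side, dropping `i` from `V` costs at most the same 2.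
  obtain ⟨C', hC', hCc⟩ : ∃ C' ⊆ C \ ({l} ×ˢ univ), #C' = 2 * m := by
    refine exists_subset_card_eq ?_
    have h1 := le_card_sdiff ({l} ×ˢ univ) C
    have h2 : #(({l} : Finset ι) ×ˢ (univ : Finset Bool)) = 2 := by simp
    omega
  have hCG : C' ⊆ G ×ˢ univ := by
    intro r hr
    have h1 := mem_sdiff.1 (hC' hr)
    have h2 : r.1 ≠ l := fun h => h1.2 (mem_product.2 ⟨mem_singleton.2 h, mem_univ _⟩)
    simp [hG, hCi r h1.1, h2]
  obtain ⟨V', hVV, hVG, hVc⟩ : ∃ V', V.erase i ⊆ V' ∧ V' ⊆ G ∧ #V' = m := by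
    refine exists_subsuperset_card_eq ?_ ?_ (by omega)
    · intro a ha
      have h1 : a ≠ l := by
        rintro rfl
        exact hVl (mem_of_mem_erase ha)
      simp [hG, ne_of_mem_erase ha, h1]
    · rw [card_erase_of_mem hVi]
      omega
  set M : Finset (ι × Bool) → ℝ :=
    fun A => 2 + max (∑ r ∈ C', fullInd A r.1) (2 * ∑ a ∈ V', freeInd A a) with hM
  have hMpos : ∀ A, 0 < M A := by
    intro A
    have : 0 ≤ max (∑ r ∈ C', fullInd A r.1) (2 * ∑ a ∈ V', freeInd A a) :=
      le_max_of_le_left (sum_nonneg fun r _ => fullInd_nonneg A _)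
    simp only [hM]
    linarith
  have hle : ∀ A ∈ powersetCard K (G ×ˢ univ), (M A)⁻¹ ≤
      (max (∑ r ∈ C, fullInd (A ∪ {l} ×ˢ univ) r.1)
        (2 * ∑ a ∈ V, freeInd (A ∪ {l} ×ˢ univ) a))⁻¹ := by
    intro A _
    refine inv_anti₀ ?_ ?_
    · exact lt_max_of_lt_left (lt_of_lt_of_le one_pos
        (one_le_sum_fullInd (by simp [fullInd]) hCl))
    · refine max_le ?_ ?_
      · refine le_trans ?_ (add_le_add_right (le_max_left _ _) 2)
        have hsub : C' ⊆ C := hC'.trans sdiff_subset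
        rw [← sum_sdiff hsub]
        refine add_le_add ?_ (le_of_eq ?_)
        · refine (sum_le_card_nsmul _ _ 1 fun r _ => fullInd_le_one _ _).trans_eq ?_
          have : #(C \ C') = 2 := by
            rw [card_sdiff_of_subset hsub]
            omega
          simp [this]
        · refine sum_congr rfl fun r hr => fullInd_union_of_ne A fun h => ?_
          exact (mem_sdiff.1 (hC' hr)).2 (mem_product.2 ⟨mem_singleton.2 h, mem_univ _⟩)
      · refine le_trans ?_ (add_le_add_right (le_max_right _ _) 2)
        rw [← add_sum_erase V _ hVi]
        have h1 := freeInd_le_one (A ∪ {l} ×ˢ univ) i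
        have h2 : ∑ a ∈ V.erase i, freeInd (A ∪ {l} ×ˢ univ) a ≤ ∑ a ∈ V', freeInd A a := by
          refine le_trans (le_of_eq ?_)
            (sum_le_sum_of_subset_of_nonneg hVV fun a _ _ => freeInd_nonneg A a)
          refine sum_congr rfl fun a ha => freeInd_union_of_ne A ?_
          rintro rfl
          exact hVl (mem_of_mem_erase ha)
        linarith
  refine le_trans ?_ (sum_le_sum hle)
  have hN : (0 : ℝ) < K.centralBinom := by exact_mod_cast K.centralBinom_pos
  have hNN : ((K + 2).centralBinom : ℝ) / 16 ≤ K.centralBinom := by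
    rw [div_le_iff₀ (by norm_num), mul_comm]
    exact_mod_cast centralBinom_add_two_le K
  have hB : (0 : ℝ) < 2 + m / 2 + m / √(3 * m + 1) := by positivity
  have hsum := sum_max_le hGc hCG hVG hCc hVc
  -- Jensen for the reciprocal: the mean of `(M A)⁻¹` is at least the inverse of the mean of `M A`.
  have hsed := sq_sum_div_le_sum_sq_div (powersetCard K (G ×ˢ (univ : Finset Bool)))
    (fun _ => (1 : ℝ)) (g := M) fun A _ => hMpos A
  simp only [sum_const, card_powersetCard_half _ _ hT, nsmul_eq_mul, mul_one, one_pow,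
    one_div] at hsed
  refine le_trans ?_ hsed
  have hne : (powersetCard K (G ×ˢ (univ : Finset Bool))).Nonempty := by
    rw [← card_pos, card_powersetCard_half _ _ hT]
    exact K.centralBinom_pos
  rw [div_le_div_iff₀ hB (sum_pos (fun A _ => hMpos A) hne)]
  calc ((K + 2).centralBinom : ℝ) / 16 * ∑ A ∈ powersetCard K (G ×ˢ univ), M A
      ≤ K.centralBinom * (K.centralBinom * (2 + m / 2 + m / √(3 * m + 1))) :=
        mul_le_mul hNN hsum (sum_nonneg fun A _ => (hMpos A).le) hN.le
    _ = _ := by ring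

end Pairs

/-! ### Pairing the reviewers along the first assignment. -/

theorem IsAssignment.card_eq {R P : Type*} [Fintype R] [Fintype P] [DecidableEq R]
    [DecidableEq P] {lrev lpap : ℕ} {A : Finset (R × P)}
    (hA : IsAssignment univ univ lrev lpap A) : #A = Fintype.card P * lpap := by
  have h : #A = ∑ p, #{r | (r, p) ∈ A} := by
    simp_rw [card_filter]
    rw [← sum_product_right', univ_product_univ, ← card_filter]
    simp
  rw [h, sum_congr rfl hA.paper_load, sum_const, card_univ, smul_eq_mul]

/-- The reviewers can be paired up so that the two reviewers assigned to a paper form a pair. -/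
theorem IsAssignment.exists_pairing {R P : Type*} [Fintype R] [Fintype P] [DecidableEq R]
    [DecidableEq P] {A : Finset (R × P)} (hA : IsAssignment univ univ 1 2 A) {k : ℕ}
    (hR : Fintype.card R = 2 * k) (hk : Fintype.card P ≤ k) :
    ∃ φ : R ≃ (P ⊕ Fin (k - Fintype.card P)) × Bool,
      ∀ r p, (φ r).1 = Sum.inl p ↔ (r, p) ∈ A := by
  classical
  have he : ∀ p, Nonempty (Bool ≃ {r // (r, p) ∈ A}) := by
    intro p
    refine Fintype.card_eq.1 ?_
    rw [Fintype.card_bool, Fintype.card_subtype, hA.paper_load p (mem_univ p)]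
  let e p := Classical.choice (he p)
  have hinj : ∀ {r p q}, (r, p) ∈ A → (r, q) ∈ A → p = q := by
    intro r p q hp hq
    exact card_le_one.1 (hA.reviewer_load r (mem_univ r)) p (by simpa using hp) q
      (by simpa using hq)
  obtain ⟨f, hf⟩ : ∃ f : (P ⊕ Fin (k - Fintype.card P)) × Bool → R,
      ∀ p b, f (Sum.inl p, b) = e p b := by
    rcases isEmpty_or_nonempty P with _ | ⟨⟨p₀⟩⟩
    · rcases isEmpty_or_nonempty R with hRe | ⟨⟨r₀⟩⟩
      · have : k = 0 := by
          rw [Fintype.card_eq_zero] at hR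
          omega
        subst this
        exact ⟨fun x => Sum.elim isEmptyElim
          (fun i => (Fin.cast (Nat.zero_sub _) i).elim0) x.1, fun p => isEmptyElim p⟩
      · exact ⟨fun _ => r₀, fun p => isEmptyElim p⟩
    · exact ⟨fun x => Sum.elim (fun p => (e p x.2 : R)) (fun _ => e p₀ true) x.1,
        fun p b => rfl⟩
  set s : Finset ((P ⊕ Fin (k - Fintype.card P)) × Bool) := {x | ∃ p, x.1 = Sum.inl p} with hs
  obtain ⟨h, hh⟩ := exists_equiv_extend_of_card_eq (t := (univ : Finset R)) (s := s) (f := f)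
    (by
      rw [card_univ, hR, Fintype.card_prod, Fintype.card_sum, Fintype.card_fin,
        Fintype.card_bool]
      omega)
    (subset_univ _) (by
      rintro ⟨x, b⟩ hx ⟨y, c⟩ hy hxy
      obtain ⟨p, rfl⟩ : ∃ p, x = Sum.inl p := by simpa [hs] using hx
      obtain ⟨q, rfl⟩ : ∃ q, y = Sum.inl q := by simpa [hs] using hy
      rw [hf, hf] at hxy
      have hpq : p = q := hinj (e p b).2 (by rw [hxy]; exact (e q c).2)
      subst hpq
      rw [(e p).injective (Subtype.ext hxy)])
  have hh' : ∀ p b, (h (Sum.inl p, b) : R) = e p b := by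
    intro p b
    rw [hh _ (by simp [hs]), hf]
  refine ⟨(h.trans (Equiv.subtypeUnivEquiv mem_univ)).symm, fun r p => ?_⟩
  constructor
  · intro hr
    set x := (h.trans (Equiv.subtypeUnivEquiv mem_univ)).symm r with hx
    have hrx : r = h x := by
      have := (h.trans (Equiv.subtypeUnivEquiv mem_univ)).apply_symm_apply r
      exact this.symm
    have hxp : x = (Sum.inl p, x.2) := Prod.ext hr rfl
    rw [hrx, hxp, hh']
    exact (e p x.2).2
  · intro hr
    have : (h.trans (Equiv.subtypeUnivEquiv mem_univ)).symm r
        = (Sum.inl p, (e p).symm ⟨r, hr⟩) := by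
      rw [Equiv.symm_apply_eq]
      change r = (h (Sum.inl p, (e p).symm ⟨r, hr⟩) : R)
      rw [hh', Equiv.apply_symm_apply]
    rw [this]

/-! ### The fractional matching and its expected weights. -/

section Weight

variable {ι P : Type*} [Fintype ι] [DecidableEq ι] [Fintype P] [DecidableEq P]

/-- The denominator of the weight of an edge `(a, p)` of `B`: the larger of the number of
reviewers that can take over paper `p`, and of twice the number of papers that `a` can take over. -/
noncomputable def contention (j : P ↪ ι) (B : Finset ((ι × Bool) × P)) (A : Finset (ι × Bool))
    (a : ι × Bool) (p : P) : ℝ :=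
  max (∑ r with (r, p) ∈ B, fullInd A r.1)
    (2 * ∑ v ∈ ({q | (a, q) ∈ B} : Finset P).map j, freeInd A v)

/-- A fractional matching of the papers with the reviewers in `A`. A paper uses the members of its
own pair as long as at least one of them is in `A`; pairs contained in `A` spend half of their
capacity on the papers whose own pair misses `A`, along the edges of `B`. -/
noncomputable def weight (j : P ↪ ι) (B : Finset ((ι × Bool) × P)) (A : Finset (ι × Bool))
    (a : ι × Bool) (p : P) : ℝ :=
  (if a.1 = j p then (if a ∈ A then 1 - fullInd A a.1 / 2 else 0) else 0) +
    if (a, p) ∈ B then fullInd A a.1 * freeInd A (j p) * (contention j B A a p)⁻¹ else 0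

theorem contention_nonneg (j : P ↪ ι) (B : Finset ((ι × Bool) × P)) (A : Finset (ι × Bool))
    (a : ι × Bool) (p : P) : 0 ≤ contention j B A a p :=
  le_max_of_le_left (sum_nonneg fun _ _ => fullInd_nonneg _ _)

theorem weight_nonneg (j : P ↪ ι) (B : Finset ((ι × Bool) × P)) (A : Finset (ι × Bool))
    (a : ι × Bool) (p : P) : 0 ≤ weight j B A a p := by
  refine add_nonneg ?_ ?_
  · split_ifs
    · linarith [fullInd_le_one A a.1]
    · exact le_rfl
    · exact le_rfl
  · split_ifs
    · exact mul_nonneg (mul_nonneg (fullInd_nonneg _ _) (freeInd_nonneg _ _))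
        (inv_nonneg.2 (contention_nonneg _ _ _ _ _))
    · exact le_rfl

theorem weight_eq_zero (j : P ↪ ι) (B : Finset ((ι × Bool) × P)) {A : Finset (ι × Bool)}
    {a : ι × Bool} (ha : a ∉ A) (p : P) : weight j B A a p = 0 := by
  simp [weight, ha, fullInd_eq_zero ha]

theorem sum_mul_inv_le {α : Type*} (s : Finset α) (f d : α → ℝ) {c : ℝ} (hc : 0 < c)
    (hf : ∀ a ∈ s, 0 ≤ f a) (hd : ∀ a ∈ s, c * ∑ b ∈ s, f b ≤ d a) :
    ∑ a ∈ s, f a * (d a)⁻¹ ≤ c⁻¹ := by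
  rcases (sum_nonneg hf).eq_or_lt with h | h
  · rw [sum_eq_zero fun a ha => by
      rw [(sum_eq_zero_iff_of_nonneg hf).1 h.symm a ha, zero_mul]]
    exact inv_nonneg.2 hc.le
  · calc ∑ a ∈ s, f a * (d a)⁻¹ ≤ ∑ a ∈ s, f a * (c * ∑ b ∈ s, f b)⁻¹ :=
          sum_le_sum fun a ha =>
            mul_le_mul_of_nonneg_left (inv_anti₀ (mul_pos hc h) (hd a ha)) (hf a ha)
      _ = c⁻¹ := by
          rw [← sum_mul, mul_inv]
          field_simp

/-- The own pair contributes exactly `1 - freeInd A (j p)`. The first entry of the maximum in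
`contention` bounds the borrowed weight by `freeInd A (j p)`. -/
theorem sum_weight_paper_le_one (j : P ↪ ι) (B : Finset ((ι × Bool) × P))
    (A : Finset (ι × Bool)) (p : P) : ∑ a, weight j B A a p ≤ 1 := by
  have h1 : ∑ a : ι × Bool, (if a.1 = j p then (if a ∈ A then 1 - fullInd A a.1 / 2 else 0) else 0)
      = 1 - freeInd A (j p) := by
    rw [Fintype.sum_prod_type, sum_eq_single (j p) (by
      intro i _ hi
      simp [hi]) (by simp), Fintype.sum_bool]
    unfold fullInd freeInd
    by_cases h1 : (j p, true) ∈ A <;> by_cases h2 : (j p, false) ∈ A <;>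
      (simp [h1, h2]; try norm_num)
  have h2 : ∑ a : ι × Bool, (if (a, p) ∈ B then
        fullInd A a.1 * freeInd A (j p) * (contention j B A a p)⁻¹ else 0)
      = freeInd A (j p) * ∑ a with (a, p) ∈ B, fullInd A a.1 * (contention j B A a p)⁻¹ := by
    rw [← sum_filter, mul_sum]
    exact sum_congr rfl fun a _ => by ring
  have h3 : ∑ a with (a, p) ∈ B, fullInd A a.1 * (contention j B A a p)⁻¹ ≤ 1⁻¹ := by
    refine sum_mul_inv_le _ _ _ one_pos (fun a _ => fullInd_nonneg _ _) fun a _ => ?_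
    rw [one_mul]
    exact le_max_left _ _
  simp only [weight]
  rw [sum_add_distrib, h1, h2]
  have := mul_le_mul_of_nonneg_left h3 (freeInd_nonneg A (j p))
  linarith

/-- The second entry of the maximum in `contention`, with its factor 2, caps the lent weight at half
the capacity, which a member of a full pair has left. -/
theorem sum_weight_reviewer_le_one (j : P ↪ ι) (B : Finset ((ι × Bool) × P))
    (A : Finset (ι × Bool)) (a : ι × Bool) : ∑ p, weight j B A a p ≤ 1 := by
  have h1 : ∑ p, (if a.1 = j p then (if a ∈ A then 1 - fullInd A a.1 / 2 else 0) else 0)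
      ≤ if a ∈ A then 1 - fullInd A a.1 / 2 else 0 := by
    rw [← sum_filter]
    refine (sum_const _).trans_le ?_
    have hc : #{p | a.1 = j p} ≤ 1 := by
      rw [card_le_one]
      intro p hp q hq
      exact j.injective ((mem_filter.1 hp).2.symm.trans (mem_filter.1 hq).2)
    rw [nsmul_eq_mul]
    exact mul_le_of_le_one_left (own_weight_nonneg A a) (by exact_mod_cast hc)
  have h2 : ∑ p, (if (a, p) ∈ B then
        fullInd A a.1 * freeInd A (j p) * (contention j B A a p)⁻¹ else 0)
      = fullInd A a.1 * ∑ p with (a, p) ∈ B, freeInd A (j p) * (contention j B A a p)⁻¹ := by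
    rw [← sum_filter, mul_sum]
    exact sum_congr rfl fun a _ => by ring
  have h3 : ∑ p with (a, p) ∈ B, freeInd A (j p) * (contention j B A a p)⁻¹ ≤ 2⁻¹ := by
    refine sum_mul_inv_le _ _ _ two_pos (fun a _ => freeInd_nonneg _ _) fun p _ => ?_
    refine le_trans (le_of_eq ?_) (le_max_right _ _)
    rw [sum_map]
  simp only [weight]
  rw [sum_add_distrib, h2]
  have h4 := mul_le_mul_of_nonneg_left h3 (fullInd_nonneg A a.1)
  refine (add_le_add h1 h4).trans ?_
  split_ifs with ha
  · linarith
  · rw [fullInd_eq_zero ha]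
    norm_num

theorem sum_own_weight_ge {k : ℕ} (hk : Fintype.card ι = k) (a : ι × Bool) :
    3 / 8 * (k.centralBinom : ℝ) ≤ ∑ A ∈ powersetCard k (univ : Finset (ι × Bool)),
      if a ∈ A then 1 - fullInd A a.1 / 2 else 0 := by
  have hT : #(univ : Finset (ι × Bool)) = 2 * k := by
    rw [card_univ, Fintype.card_prod, hk, Fintype.card_bool, mul_comm]
  have h1 := sum_powersetCard_compl (univ : Finset (ι × Bool)) k hT
    fun A => if a ∈ A then (1 : ℝ) else 0
  have h2 : ∑ A ∈ powersetCard k (univ : Finset (ι × Bool)), (if a ∈ A then (1 : ℝ) else 0)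
      + ∑ A ∈ powersetCard k (univ : Finset (ι × Bool)), (if a ∈ univ \ A then (1 : ℝ) else 0)
      = k.centralBinom := by
    rw [← sum_add_distrib, ← card_powersetCard_half _ _ hT, ← nsmul_one]
    refine sum_eq_card_nsmul fun A _ => ?_
    by_cases h : a ∈ A <;> simp [h]
  have h3 := sum_fullInd_le (G := univ) (K := k) (by rw [card_univ, hk]) (mem_univ a.1)
  rw [univ_product_univ] at h3
  have h4 : ∀ A : Finset (ι × Bool), (if a ∈ A then 1 - fullInd A a.1 / 2 else 0)
      = (if a ∈ A then (1 : ℝ) else 0) - fullInd A a.1 / 2 := by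
    intro A
    split_ifs with ha
    · rfl
    · simp [fullInd_eq_zero ha]
  simp_rw [h4]
  rw [sum_sub_distrib, ← sum_div]
  linarith

theorem sum_weight_ge {k m : ℕ} (hk : Fintype.card ι = k) (j : P ↪ ι)
    (B : Finset ((ι × Bool) × P)) (hcol : ∀ p, #{a | (a, p) ∈ B} = 2 * (m + 1))
    (hrow : ∀ a, #{p | (a, p) ∈ B} ≤ m + 1)
    (hB : ∀ a p, (a, p) ∈ B → a.1 ≠ j p)
    (a : ι × Bool) (p : P) :
    (k.centralBinom : ℝ) * ((if a.1 = j p then 3 / 8 else 0) +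
        if (a, p) ∈ B then 1 / 16 / (2 + m / 2 + m / √(3 * m + 1)) else 0) ≤
      ∑ A ∈ powersetCard k (univ : Finset (ι × Bool)), weight j B A a p := by
  simp only [weight]
  rw [sum_add_distrib, mul_add]
  refine add_le_add ?_ ?_
  · split_ifs with h
    · rw [mul_comm]
      exact sum_own_weight_ge hk a
    · simp
  · split_ifs with h
    -- The `2 * (m + 1)` reviewers of `p` in `B` are distinct from the two in its own pair, so there
    -- are at least `2 * m + 4` reviewers.
    · have hmk : m + 2 ≤ k := by
        have h1 : Disjoint ({a | (a, p) ∈ B} : Finset (ι × Bool)) ({j p} ×ˢ univ) := by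
          rw [disjoint_left]
          intro a ha ha'
          exact hB a p (mem_filter.1 ha).2 (mem_singleton.1 (mem_product.1 ha').1)
        have h2 := card_le_univ (({a | (a, p) ∈ B} : Finset (ι × Bool)) ∪ {j p} ×ˢ univ)
        rw [card_union_of_disjoint h1, hcol, card_product, Fintype.card_prod, hk, card_singleton,
          card_univ, Fintype.card_bool] at h2
        omega
      have := sum_edge_weight_ge hk hmk (i := j p) (l := a.1) (b := a.2)
        (C := {a | (a, p) ∈ B}) (V := ({q | (a, q) ∈ B} : Finset P).map j) (hcol p)
        (fun r hr => hB r p (mem_filter.1 hr).2) (by simpa using h)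
        (by rw [card_map]; exact hrow a) (by simpa using h) (by
          intro hV
          obtain ⟨q, hq, hqa⟩ := mem_map.1 hV
          exact hB a q (mem_filter.1 hq).2 hqa.symm)
      refine le_trans (le_of_eq ?_) this
      ring
    · simp

end Weight

/-! ### Numerical estimates. -/

theorem one_sub_div_sqrt_le (m : ℕ) :
    (1 - 1.43 / √((m + 1 : ℕ) : ℝ)) / 4 ≤
      ((m + 1 : ℕ) : ℝ) / 8 / (2 + m / 2 + m / √(3 * m + 1)) := by
  set s : ℝ := √((m + 1 : ℕ) : ℝ) with hs
  have hs2 : s ^ 2 = m + 1 := by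
    rw [hs, Real.sq_sqrt (by positivity)]
    push_cast
    ring
  have hs0 : 0 < s := Real.sqrt_pos.2 (by positivity)
  have hm : (0 : ℝ) ≤ m := Nat.cast_nonneg m
  -- 0.58 is slightly more than `1 / √3`, the limiting ratio.
  have hq : (m : ℝ) / √(3 * m + 1) ≤ 0.58 * s := by
    rw [div_le_iff₀ (by positivity)]
    refine abs_le_of_sq_le_sq' ?_ (by positivity) |>.2
    rw [mul_pow, mul_pow, hs2, Real.sq_sqrt (by positivity)]
    nlinarith
  have hB : 0 < 2 + (m : ℝ) / 2 + m / √(3 * m + 1) := by positivity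
  rw [div_div, div_le_div_iff₀ (by norm_num) (by positivity)]
  have hms : ((m + 1 : ℕ) : ℝ) = s ^ 2 := by rw [hs2]; push_cast; ring
  rw [hms]
  rcases le_total s 1.43 with h | h
  · have : 1 - 1.43 / s ≤ 0 := by
      rw [sub_nonpos, le_div_iff₀ hs0]
      linarith
    nlinarith [sq_nonneg s, mul_nonneg hB.le (neg_nonneg.2 this)]
  · have h1 : 0 ≤ 1 - 1.43 / s := by
      rw [sub_nonneg, div_le_iff₀ hs0]
      linarith
    have h2 : 2 + (m : ℝ) / 2 + m / √(3 * m + 1) ≤ (s ^ 2 + 3) / 2 + 0.58 * s := by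
      rw [hs2]
      linarith
    have h3 : (1 - 1.43 / s) * ((s ^ 2 + 3) / 2 + 0.58 * s) ≤ s ^ 2 / 2 := by
      have : (1 - 1.43 / s) = (s - 1.43) / s := by field_simp
      rw [this, div_mul_eq_mul_div, div_le_iff₀ hs0]
      -- After expansion the cubic terms cancel, leaving a negative definite quadratic with vertex
      -- near 2.48.
      nlinarith [sq_nonneg (s - 2.48)]
    have := mul_le_mul_of_nonneg_left h2 h1
    linarith

theorem le_sqrt_seven_add_sqrt_six_div (x : ℝ) (hx : 0 < x) :
    1.43 / √x ≤ (√7 + √6) / (2 * √(Real.pi * x)) := by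
  -- The margin is thin: 2 · 1.43 · 1.7734 is about 5.072, against 2.64 + 2.44 = 5.08.
  have h7 : (2.64 : ℝ) ≤ √7 := Real.le_sqrt_of_sq_le (by norm_num)
  have h6 : (2.44 : ℝ) ≤ √6 := Real.le_sqrt_of_sq_le (by norm_num)
  have hpi : √Real.pi ≤ 1.7734 := Real.sqrt_le_iff.2 ⟨by norm_num, by
    have := Real.pi_lt_d4
    norm_num at this ⊢
    linarith⟩
  have hx' : 0 < √x := Real.sqrt_pos.2 hx
  have hp' : 0 < √Real.pi := Real.sqrt_pos.2 Real.pi_pos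
  rw [Real.sqrt_mul Real.pi_pos.le, div_le_div_iff₀ hx' (by positivity)]
  nlinarith

/-! ### From the expected optimum to the value of random split. -/

theorem totalSim_eq_sum {R P : Type*} [Fintype R] [Fintype P] [DecidableEq R] [DecidableEq P]
    (S : R → P → ℝ) (A : Finset (R × P)) :
    totalSim S A = ∑ r, ∑ p, if (r, p) ∈ A then S r p else 0 := by
  rw [totalSim, ← sum_product', univ_product_univ, ← sum_filter]
  simp

theorem randomSplitValue_eq {R P : Type*} [Fintype R] [Fintype P] [DecidableEq R]
    [DecidableEq P] (S : R → P → ℝ) {k : ℕ} (hR : Fintype.card R = 2 * k) :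
    randomSplitValue S k (Fintype.card P) =
      (∑ A ∈ powersetCard k (univ : Finset R), optSim S A univ) /
        (k.centralBinom * Fintype.card P) := by
  have hT : #(univ : Finset R) = 2 * k := by rw [card_univ, hR]
  have h1 : ∀ A : Finset R, expectedValue S (Fintype.card P) A =
      (optSim S (univ \ A) univ + optSim S A univ) / (2 * Fintype.card P) := by
    intro A
    rw [expectedValue, ← card_univ, powersetCard_self, expect_singleton, splitValue, ← card_univ]
    rw [two_mul]
  rw [randomSplitValue, expect_eq_sum_div_card, card_powersetCard_half _ _ hT]
  simp_rw [h1]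
  -- Complementation permutes the sets of size `k`, so both stages contribute equally.
  rw [← sum_div, sum_add_distrib,
    sum_powersetCard_compl univ k hT fun A => optSim S A (univ : Finset P), div_div]
  rw [← two_mul, show (2 : ℝ) * Fintype.card P * k.centralBinom
    = 2 * (k.centralBinom * Fintype.card P) by ring, mul_div_mul_left _ _ two_ne_zero]

theorem sum_optSim_ge {R P ι : Type*} [Fintype R] [Fintype P] [Fintype ι] [DecidableEq R]
    [DecidableEq P] [DecidableEq ι] (S : R → P → ℝ) (hS : ∀ r p, 0 ≤ S r p) {k m : ℕ}
    (hι : Fintype.card ι = k) (hk : Fintype.card P ≤ k) {A₁ A₂ : Finset (R × P)}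
    (φ : R ≃ ι × Bool) (j : P ↪ ι) (hφ : ∀ r p, (φ r).1 = j p ↔ (r, p) ∈ A₁)
    (hA₂ : IsAssignment univ univ (m + 1) (2 * (m + 1)) A₂) (hdisj : Disjoint A₁ A₂) :
    (k.centralBinom : ℝ) * (3 / 8 * totalSim S A₁ +
        1 / 16 / (2 + m / 2 + m / √(3 * m + 1)) * totalSim S A₂) ≤
      ∑ A ∈ powersetCard k (univ : Finset R), optSim S A univ := by
  set B : Finset ((ι × Bool) × P) := A₂.map (φ.prodCongr (Equiv.refl P)).toEmbedding with hB
  have hmB : ∀ r p, (φ r, p) ∈ B ↔ (r, p) ∈ A₂ := by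
    intro r p
    rw [hB, mem_map_equiv]
    simp
  have hcol : ∀ p, #{a | (a, p) ∈ B} = 2 * (m + 1) := by
    intro p
    rw [← hA₂.paper_load p (mem_univ p), ← card_map φ.toEmbedding]
    congr 1
    ext a
    obtain ⟨r, rfl⟩ := φ.surjective a
    simp [hmB]
  have hrow : ∀ a, #{p | (a, p) ∈ B} ≤ m + 1 := by
    intro a
    obtain ⟨r, rfl⟩ := φ.surjective a
    simpa only [hmB] using hA₂.reviewer_load r (mem_univ r)
  have hne : ∀ a p, (a, p) ∈ B → a.1 ≠ j p := by
    intro a p h h'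
    obtain ⟨r, rfl⟩ := φ.surjective a
    exact disjoint_left.1 hdisj ((hφ r p).1 h') ((hmB r p).1 h)
  have hle : ∀ A ∈ powersetCard k (univ : Finset R),
      ∑ r, ∑ p, S r p * weight j B (A.map φ.toEmbedding) (φ r) p ≤ optSim S A univ := by
    intro A hA
    refine sum_mul_le_optSim S hS A ?_ _ (fun r p => weight_nonneg _ _ _ _ _) ?_
      (fun r => sum_weight_reviewer_le_one _ _ _ _) ?_
    · rw [(mem_powersetCard.1 hA).2]
      exact hk
    · intro r hr p
      exact weight_eq_zero _ _ (by simpa using hr) p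
    · intro p
      rw [Equiv.sum_comp φ fun a => weight j B (A.map φ.toEmbedding) a p]
      exact sum_weight_paper_le_one _ _ _ _
  refine le_trans ?_ (sum_le_sum hle)
  rw [sum_comm, totalSim_eq_sum, totalSim_eq_sum, mul_sum, mul_sum, ← sum_add_distrib, mul_sum]
  refine sum_le_sum fun r _ => ?_
  rw [sum_comm, mul_sum, mul_sum, ← sum_add_distrib, mul_sum]
  refine sum_le_sum fun p _ => ?_
  rw [← mul_sum]
  have hmap : ∑ A ∈ powersetCard k (univ : Finset R), weight j B (A.map φ.toEmbedding) (φ r) p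
      = ∑ A ∈ powersetCard k (univ : Finset (ι × Bool)), weight j B A (φ r) p := by
    rw [← map_univ_equiv φ, powersetCard_map, sum_map]
    rfl
  rw [hmap]
  refine le_trans (le_of_eq ?_)
    (mul_le_mul_of_nonneg_left (sum_weight_ge hι j B hcol hrow hne (φ r) p) (hS r p))
  have e1 : ((φ r).1 = j p) ↔ (r, p) ∈ A₁ := hφ r p
  simp only [e1, hmB]
  split_ifs <;> ring

theorem randomSplitValue_ge {R P : Type*} [Fintype R] [Fintype P] [DecidableEq R] [DecidableEq P]
    [Nonempty P] (S : R → P → ℝ) (hS : ∀ r p, 0 ≤ S r p) {k μ : ℕ} (hμ : 1 ≤ μ)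
    (hR : Fintype.card R = 2 * k) (hk : Fintype.card P ≤ k) {A₁ A₂ : Finset (R × P)}
    (hA₁ : IsAssignment univ univ 1 2 A₁) (hA₂ : IsAssignment univ univ μ (2 * μ) A₂)
    (hdisj : Disjoint A₁ A₂) :
    3 / 4 * meanSim S A₁ + (1 - 1.43 / √(μ : ℝ)) / 4 * meanSim S A₂ ≤
      randomSplitValue S k (Fintype.card P) := by
  obtain ⟨m, rfl⟩ := Nat.exists_eq_add_of_le' hμ
  obtain ⟨φ, hφ⟩ := hA₁.exists_pairing hR hk
  have h := sum_optSim_ge S hS (by rw [Fintype.card_sum, Fintype.card_fin]; omega) hk φ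
    Function.Embedding.inl hφ hA₂ hdisj
  have hn : (0 : ℝ) < Fintype.card P := by exact_mod_cast Fintype.card_pos
  have hN : (0 : ℝ) < k.centralBinom := by exact_mod_cast k.centralBinom_pos
  have ht₁ : totalSim S A₁ = 2 * Fintype.card P * meanSim S A₁ := by
    rw [meanSim, hA₁.card_eq]
    push_cast
    field_simp
  have ht₂ : totalSim S A₂ = 2 * ((m + 1 : ℕ) : ℝ) * Fintype.card P * meanSim S A₂ := by
    rw [meanSim, hA₂.card_eq]
    push_cast
    field_simp
  have hs₂ : 0 ≤ meanSim S A₂ := div_nonneg (sum_nonneg fun _ _ => hS _ _) (Nat.cast_nonneg _)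
  have h1 := mul_le_mul_of_nonneg_right (one_sub_div_sqrt_le m) hs₂
  rw [randomSplitValue_eq S hR, le_div_iff₀ (mul_pos hN hn)]
  refine le_trans ?_ h
  rw [ht₁, ht₂]
  calc _ ≤ (3 / 4 * meanSim S A₁ + ((m + 1 : ℕ) : ℝ) / 8 / (2 + m / 2 + m / √(3 * m + 1))
          * meanSim S A₂) * (k.centralBinom * Fintype.card P) :=
        mul_le_mul_of_nonneg_right (by linarith) (mul_pos hN hn).le
    _ = _ := by ring

end TwoStage

theorem theorem6 {R P : Type*} [Fintype R] [Fintype P] [DecidableEq R] [DecidableEq P] [Nonempty P]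
    (S : R → P → ℝ) (hS : ∀ r p, S r p ∈ Set.Icc (0 : ℝ) 1)
    (k : ℕ) (hR : Fintype.card R = 2 * k) (hk : Fintype.card P ≤ k)
    (μ : ℕ) (hμ : μ ∈ Finset.Icc 1 10000)
    (A₁ Aμ : Finset (R × P))
    (hA₁ : TwoStage.IsAssignment Finset.univ Finset.univ 1 2 A₁)
    (hAμ : TwoStage.IsAssignment Finset.univ Finset.univ μ (2 * μ) Aμ)
    (hdisj : Disjoint A₁ Aμ) :
    (4 ∣ μ →
      3 / 4 * TwoStage.meanSim S A₁
          + (1 - 1.44 / Real.sqrt (μ : ℝ)) * (1 / 4) * TwoStage.meanSim S Aμ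
        ≤ TwoStage.randomSplitValue S k (Fintype.card P)) ∧
    (∀ ε : ℝ, ε = (⌈(μ : ℝ) / 4⌉ : ℝ) - (μ : ℝ) / 4 →
      3 / 4 * TwoStage.meanSim S A₁
          + TwoStage.meanSim S Aμ / 4 *
            (1 - (Real.sqrt 7 + Real.sqrt 6) / (2 * Real.sqrt (Real.pi * (μ : ℝ)))
              - 3 * ε / (⌈(μ : ℝ) / 4⌉ : ℝ))
        ≤ TwoStage.randomSplitValue S k (Fintype.card P)) := by
  have hμ1 : 1 ≤ μ := (Finset.mem_Icc.1 hμ).1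
  have hμ0 : (0 : ℝ) < μ := by exact_mod_cast hμ1
  have h := TwoStage.randomSplitValue_ge S (fun r p => (hS r p).1) hμ1 hR hk hA₁ hAμ hdisj
  have hs : 0 ≤ TwoStage.meanSim S Aμ :=
    div_nonneg (Finset.sum_nonneg fun a _ => (hS a.1 a.2).1) (Nat.cast_nonneg _)
  -- Both bounds weaken the one with 1.43: the first since 1.43 ≤ 1.44, the second since `(√7 + √6)
  -- / (2 * √π)` is about 1.437 and the `ε` term is nonnegative.
  refine ⟨fun _ => le_trans ?_ h, fun ε hε => le_trans ?_ h⟩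
  · have h1 : 1.43 / √(μ : ℝ) ≤ 1.44 / √(μ : ℝ) :=
      div_le_div_of_nonneg_right (by norm_num) (Real.sqrt_nonneg _)
    have := mul_le_mul_of_nonneg_right h1 hs
    linarith
  · have h1 := TwoStage.le_sqrt_seven_add_sqrt_six_div μ hμ0
    have h2 : 0 ≤ 3 * ε / (⌈(μ : ℝ) / 4⌉ : ℝ) := by
      refine div_nonneg ?_ ?_
      · have := Int.le_ceil ((μ : ℝ) / 4)
        linarith
      · exact_mod_cast Int.ceil_nonneg (by positivity : (0 : ℝ) ≤ (μ : ℝ) / 4)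
    have := mul_le_mul_of_nonneg_left
      (show 1 - (√7 + √6) / (2 * √(Real.pi * (μ : ℝ))) - 3 * ε / (⌈(μ : ℝ) / 4⌉ : ℝ)
        ≤ 1 - 1.43 / √(μ : ℝ) by linarith) hs
    linarith
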